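/- **Discrete Kyle game.** Let $T,N,K,L\ge 1$ be integers and let $I=\{1,\dots,N\}$ be the set of information states. The true value of an asset is a function $i\mapsto v^i\in\mathbb R$ on $I$ with $v^1\ge\dots\ge v^N$. Let $\mathcal I_1,\dots,\mathcal I_T$ be a refining sequence of partitions of $I$ (every cell of $\mathcal I_{t+1}$ is contained in a cell of $\mathcal I_t$). Let $E_X,E_Z\subset\mathbb R$ be finite sets with $K$ and $L$ elements (the possible trades of the insider and of the noise trader), and let $E_Y=\{x+z: x\in E_X,\ z\in E_Z\}$. For a finite set $A$ let $\Delta A$ be the set of probability distributions on $A$. Fix $\nu\in\Delta I$ and $\zeta\in\Delta E_Z$, both strictly positive at every point. A *behaviour strategy* $\xi$ assigns to every node $\tau=(I_1,x_1,z_1,\dots,I_{t-1},x_{t-1},z_{t-1},I_t)$, where $1\le t\le T$, $x_s\in E_X$, $z_s\in E_Z$, $I_s\in\mathcal I_s$ and $I_1\supseteq\dots\supseteq I_t$, a distribution $\xi(\tau,\cdot)\in\Delta E_X$. A *pricing system* $S=(S_t)_{t=1}^T$ is a family of functions $S_t:(E_Y)^t\to[v^N,v^1]$. The *outcomes* are $\omega=(I_1,x_1,z_1,\dots,I_T,x_T,z_T,i)$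 with $x_s\in E_X$, $z_s\in E_Z$, $I_s\in\mathcal I_s$, $I_1\supseteq\dots\supseteq I_T\ni i$; their probability under $\xi$ is $$p^\xi(\omega)=\nu(\{i\})\prod_{s=1}^T\xi\big((I_1,x_1,z_1,\dots,I_s),\{x_s\}\big)\,\zeta(\{z_s\}).$$ The insider's expected profit is $$u(\xi,S)=\sum_\omega p^\xi(\omega)\sum_{t=1}^T\big[v^i-S_t(x_1+z_1,\dots,x_t+z_t)\big]\,x_t .$$ Let $p^\xi_Y(i,y_1,\dots,y_t)$ be the sum of $p^\xi(\omega)$ over all outcomes $\omega$ with final state $i$ and $x_s+z_s=y_s$ for $s=1,\dots,t$, and let $p^\xi_Y(y_1,\dots,y_t)=\sum_{i=1}^N p^\xi_Y(i,y_1,\dots,y_t)$. **Theorem.** Every discrete Kyle game has a Kyle equilibrium, that is, there are a behaviour strategy $\xi^\star$ and a pricing system $S^\star$ such that 1. (profit maximisation) $u(\xi^\star,S^\star)\ge u(\xi,S^\star)$ for every behaviour strategy $\xi$; 2. (rational pricing) for all $t\in\{1,\dots,T\}$ and all $(y_1,\dots,y_t)\in(E_Y)^t$ with $p^{\xi^\star}_Y(y_1,\dots,y_t)>0$,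 $$S^\star_t(y_1,\dots,y_t)=\sum_{i=1}^N\frac{p^{\xi^\star}_Y(i,y_1,\dots,y_t)}{p^{\xi^\star}_Y(y_1,\dots,y_t)}\,v^i .$$ -/

import Mathlib

/-- The data of a discrete Kyle game. Trading rounds are indexed by `Fin T`, fundamental information
states by `Fin N` (both zero-based), and `ΔA` is `stdSimplex ℝ A`. -/
structure KyleGame where
  /-- number of trading rounds -/
  T : ℕ
  T_pos : 0 < T
  /-- number of fundamental information states -/
  N : ℕ
  N_pos : 0 < N
  /-- true value of the asset, nonincreasing in the state -/
  v : Fin N → ℝ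
  v_anti : Antitone v
  /-- the partition of the states that the insider is informed of in each round -/
  info : Fin T → Finpartition (Finset.univ : Finset (Fin N))
  /-- the partitions get finer (`P ≤ Q` means that each cell of `P` lies in a cell of `Q`) -/
  info_refining : Antitone info
  /-- possible trades of the insider -/
  EX : Finset ℝ
  EX_nonempty : EX.Nonempty
  /-- possible trades of the noise trader (nonempty, since it carries a probability distribution) -/
  EZ : Finset ℝ
  /-- distribution of the information state -/
  ν : stdSimplex ℝ (Fin N)
  ν_pos : ∀ i, 0 < ν i
  /-- distribution of the noise trader's order in each round -/
  ζ : stdSimplex ℝ EZ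
  ζ_pos : ∀ z, 0 < ζ z

namespace KyleGame

variable (G : KyleGame)

/-- The largest true value `v¹`. -/
def vMax : ℝ := G.v ⟨0, G.N_pos⟩

/-- The smallest true value `vᴺ`. -/
def vMin : ℝ := G.v ⟨G.N - 1, Nat.sub_lt G.N_pos Nat.one_pos⟩

/-- Possible total orders `x + z`. -/
noncomputable def EY : Finset ℝ := Finset.image₂ (fun x z : ℝ => x + z) G.EX G.EZ

/-- The insider's nodes `(I₁, x₁, z₁, …, I_{t-1}, x_{t-1}, z_{t-1}, I_t)` in round `t`: a decreasing
chain of cells up to and including round `t`, and the trades of all rounds strictly before `t`. -/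
@[ext]
structure InsiderNode (t : Fin G.T) where
  /-- the cells `I₁ ⊇ … ⊇ I_t` -/
  cell : Set.Iic t → Finset (Fin G.N)
  cell_mem : ∀ s : Set.Iic t, cell s ∈ (G.info s).parts
  cell_anti : Antitone cell
  /-- past trades of the insider -/
  x : Set.Iio t → G.EX
  /-- past trades of the noise trader -/
  z : Set.Iio t → G.EZ

/-- The terminal nodes `(I₁, x₁, z₁, …, I_T, x_T, z_T, {i})` of the game tree. -/
@[ext]
structure Outcome where
  /-- the cells `I₁ ⊇ … ⊇ I_T` -/
  cell : Fin G.T → Finset (Fin G.N)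
  cell_mem : ∀ t, cell t ∈ (G.info t).parts
  cell_anti : Antitone cell
  /-- the information state `i` revealed after trading -/
  state : Fin G.N
  state_mem : ∀ t, state ∈ cell t
  /-- trades of the insider -/
  x : Fin G.T → G.EX
  /-- trades of the noise trader -/
  z : Fin G.T → G.EZ

/-- The state determines the chain of cells, so that an outcome amounts to a state together with the
trades. -/
def outcomeEquiv : G.Outcome ≃ Fin G.N × (Fin G.T → G.EX) × (Fin G.T → G.EZ) where
  toFun ω := (ω.state, ω.x, ω.z)
  invFun q :=
    { cell := fun t => (G.info t).part q.1
      cell_mem := fun t => (G.info t).part_mem.2 (Finset.mem_univ _)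
      cell_anti := by
        intro s t hst
        obtain ⟨c, hc, hle⟩ :=
          G.info_refining hst ((G.info t).part_mem.2 (Finset.mem_univ q.1))
        have hq : q.1 ∈ c := hle ((G.info t).mem_part (Finset.mem_univ q.1))
        have h : (G.info s).part q.1 = c := (G.info s).part_eq_of_mem hc hq
        change (G.info t).part q.1 ⊆ (G.info s).part q.1
        rw [h]
        exact hle
      state := q.1
      state_mem := fun t => (G.info t).mem_part (Finset.mem_univ _)
      x := q.2.1
      z := q.2.2 }
  left_inv ω := by
    ext1
    · funext t
      exact (G.info t).part_eq_of_mem (ω.cell_mem t) (ω.state_mem t)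
    all_goals rfl
  right_inv _ := rfl

noncomputable instance : Fintype G.Outcome := Fintype.ofEquiv _ G.outcomeEquiv.symm

variable {G}

/-- The insider's node in round `t` on the path to the terminal node `ω`. -/
def Outcome.node (ω : G.Outcome) (t : Fin G.T) : G.InsiderNode t where
  cell s := ω.cell s
  cell_mem s := ω.cell_mem s
  cell_anti _ _ h := ω.cell_anti h
  x s := ω.x s
  z s := ω.z s

/-- The total order in round `t`. -/
def Outcome.flow (ω : G.Outcome) (t : Fin G.T) : G.EY :=
  ⟨ω.x t + ω.z t, Finset.mem_image₂_of_mem (ω.x t).2 (ω.z t).2⟩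

variable (G)

/-- Behaviour strategies of the insider: a distribution over trades at each of her nodes. -/
abbrev BehaviourStrategy : Type := (t : Fin G.T) → G.InsiderNode t → stdSimplex ℝ G.EX

/-- Pricing systems of the market maker: the price in round `t` is a function of the total orders
of the rounds up to and including `t`, with values in `[vᴺ, v¹]`. -/
abbrev PricingSystem : Type :=
  (t : Fin G.T) → (Set.Iic t → G.EY) → Set.Icc G.vMin G.vMax

variable {G}

/-- The realisation probability `p^ξ(ω)`. -/
noncomputable def prob (ξ : G.BehaviourStrategy) (ω : G.Outcome) : ℝ :=
  G.ν ω.state *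
    ∏ s : Fin G.T, (ξ s (ω.node s) (ω.x s) * G.ζ (ω.z s))

/-- The insider's payoff `U(ω, S)`. -/
noncomputable def payoff (ω : G.Outcome) (S : G.PricingSystem) : ℝ :=
  ∑ t : Fin G.T, (G.v ω.state - (S t (fun s => ω.flow s) : ℝ)) * (ω.x t : ℝ)

/-- The insider's expected utility `u(ξ, S)`. -/
noncomputable def utility (ξ : G.BehaviourStrategy) (S : G.PricingSystem) : ℝ :=
  ∑ ω : G.Outcome, prob ξ ω * payoff ω S

open Classical in
/-- The joint probability `p_Y^ξ(i, y₁, …, y_t)` of the state and the order flow up to round `t`. -/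
noncomputable def jointProb (ξ : G.BehaviourStrategy) (t : Fin G.T) (i : Fin G.N)
    (y : Set.Iic t → G.EY) : ℝ :=
  ∑ ω : G.Outcome with ω.state = i ∧ ∀ s : Set.Iic t, ω.flow s = y s, prob ξ ω

/-- The probability `p_Y^ξ(y₁, …, y_t)` of the order flow up to round `t`. -/
noncomputable def flowProb (ξ : G.BehaviourStrategy) (t : Fin G.T) (y : Set.Iic t → G.EY) : ℝ :=
  ∑ i : Fin G.N, jointProb ξ t i y

/-- The conditional probability `p_Y^ξ(i ∣ y₁, …, y_t)` by Bayes' rule; it is meaningful, and used,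
only if `0 < flowProb ξ t y`. -/
noncomputable def condProb (ξ : G.BehaviourStrategy) (t : Fin G.T) (i : Fin G.N)
    (y : Set.Iic t → G.EY) : ℝ :=
  jointProb ξ t i y / flowProb ξ t y

/-- `S` is rational assuming the insider plays `ξ`: at each order flow of positive probability the
price is the conditional expectation of the true value. -/
def IsRational (S : G.PricingSystem) (ξ : G.BehaviourStrategy) : Prop :=
  ∀ (t : Fin G.T) (y : Set.Iic t → G.EY), 0 < flowProb ξ t y →
    (S t y : ℝ) = ∑ i : Fin G.N, condProb ξ t i y * G.v i

/-- Kyle equilibrium: profit maximisation and rational pricing. -/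
structure IsKyleEquilibrium (ξ : G.BehaviourStrategy) (S : G.PricingSystem) : Prop where
  profit_max : ∀ ξ' : G.BehaviourStrategy, utility ξ' S ≤ utility ξ S
  rational : IsRational S ξ

end KyleGame

/-! An equilibrium solves a variational inequality. Describe the insider by the outcome distribution
`prob ξ` instead of `ξ`: her payoff is then linear, and by Kuhn's theorem (`convex_range_prob`) the
attainable distributions form a convex set, compact because `prob` is continuous. Give the market
maker a quadratic pricing error at each order flow. On the product of the distributions with the box
of prices, the field of marginal incentives (`gameField`) is continuous, so some point admits no
improving direction (`exists_variational_solution`). The insider's part of the inequality is profit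
maximisation; the market maker's part forces the conditional expectation wherever the order flow has
positive probability. The variational inequality follows from Brouwer's theorem applied to a metric
projection. Brouwer's theorem is proved by volume: the integral of `det (1 + t • Dh)` does not
depend on `t`, whereas a zero-free map equal to the identity outside a ball would yield an `h` for
which it vanishes at `t = 1`. -/

/-! ### Volume under perturbations of the identity. -/

/-- The determinant is a polynomial in `t` of degree at most the dimension, hence equal to its
Lagrange interpolant. The weights do not depend on `A`, so the identity can be integrated over a
family of `A`. -/
theorem continuousLinearMap_det_one_add_smul_eq_sum {E : Type*} [NormedAddCommGroup E]
    [NormedSpace ℝ E] [FiniteDimensional ℝ E] (A : E →L[ℝ] E) {s : Finset ℕ} {v : ℕ → ℝ}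
    (hv : Set.InjOn v s) (hs : Module.finrank ℝ E < s.card) (t : ℝ) :
    (1 + t • A).det = ∑ i ∈ s, (1 + v i • A).det * (Lagrange.basis s v i).eval t := by
  classical
  let b := Module.finBasis ℝ E
  let M := LinearMap.toMatrix b b (A : E →ₗ[ℝ] E)
  let p : Polynomial ℝ := Matrix.det ((Polynomial.X : Polynomial ℝ) • M.map Polynomial.C
    + (1 : Matrix _ _ ℝ).map Polynomial.C)
  have hp : ∀ r : ℝ, p.eval r = (1 + r • A).det := by
    intro r
    have h1 : (1 + r • A).det = Matrix.det (1 + r • M) := by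
      rw [ContinuousLinearMap.det, ← LinearMap.det_toMatrix b]
      congr 1
      simp [M, LinearMap.toMatrix_one]
    rw [h1]
    change Polynomial.evalRingHom r p = _
    rw [RingHom.map_det]
    congr 1
    ext i j
    by_cases hij : i = j
    · subst hij
      simp [add_comm, mul_comm r]
    · simp [hij, mul_comm r]
  have hdeg : p.degree < s.card := by
    refine lt_of_le_of_lt Polynomial.degree_le_natDegree ?_
    have := Polynomial.natDegree_det_X_add_C_le M 1
    rw [Fintype.card_fin] at this
    exact_mod_cast lt_of_le_of_lt this hs
  have := congrArg (Polynomial.eval t) (Lagrange.eq_interpolate hv hdeg)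
  rw [hp, Lagrange.interpolate_apply, Polynomial.eval_finsetSum] at this
  simpa [hp] using this

open MeasureTheory in
theorem integrableOn_det_one_add_smul_fderiv {E : Type*} [NormedAddCommGroup E]
    [NormedSpace ℝ E] [FiniteDimensional ℝ E] [MeasurableSpace E] [BorelSpace E]
    (μ : Measure E) {h : E → E} {K : NNReal} (hL : LipschitzWith K h) {B : Set E}
    (hB : μ B ≠ ⊤) (t : ℝ) :
    IntegrableOn (fun x => (1 + t • fderiv ℝ h x).det) B μ := by
  have hcont : Continuous fun A : E →L[ℝ] E => (1 + t • A).det :=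
    ContinuousLinearMap.continuous_det.comp (by fun_prop)
  obtain ⟨M, hM⟩ := ((ProperSpace.isCompact_closedBall (0 : E →L[ℝ] E) K).image
    hcont).isBounded.exists_norm_le
  refine Measure.integrableOn_of_bounded (M := M) hB
    (hcont.measurable.comp (measurable_fderiv ℝ h)).aestronglyMeasurable ?_
  refine Filter.Eventually.of_forall fun x => hM _ ⟨fderiv ℝ h x, ?_, rfl⟩
  simpa using norm_fderiv_le_of_lipschitz ℝ hL

-- For small `t` the map `x + t • h x` is a bijection (`t • h` is a contraction) fixing every point
-- off `B`, so it permutes `B`. Its Jacobian is positive, and the change of variables formula gives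
-- the volume of `B`.
open MeasureTheory in
theorem integral_det_one_add_smul_fderiv_of_small {E : Type*} [NormedAddCommGroup E]
    [NormedSpace ℝ E] [FiniteDimensional ℝ E] [MeasurableSpace E] [BorelSpace E]
    (μ : Measure E) [μ.IsAddHaarMeasure] {h : E → E} {K : NNReal} (hL : LipschitzWith K h)
    {B : Set E} (hBo : IsOpen B) (h0 : ∀ x, x ∉ B → h x = 0) (hd : DifferentiableOn ℝ h B) :
    ∃ t₀ > 0, ∀ t : ℝ, 0 ≤ t → t < t₀ →
      ∫ x in B, (1 + t • fderiv ℝ h x).det ∂μ = μ.real B := by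
  have hpos : ∀ᶠ A : E →L[ℝ] E in nhds 1, 0 < A.det := by
    refine ContinuousLinearMap.continuous_det.continuousAt.eventually (lt_mem_nhds ?_)
    simp [ContinuousLinearMap.det]
  obtain ⟨ε, hε, hdet⟩ := Metric.eventually_nhds_iff.1 hpos
  -- This bound gives both `t * K < 1` (contraction) and `t * K < ε` (positive determinant); `K + 1`
  -- avoids dividing by zero.
  refine ⟨min ε 1 / (K + 1), by positivity, fun t ht htlt => ?_⟩
  have htK : t * (K + 1) < min ε 1 := (lt_div_iff₀ (by positivity)).1 htlt
  have htK1 : t * K < 1 := by nlinarith [min_le_right ε 1]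
  have htKε : t * K < ε := by nlinarith [min_le_left ε 1]
  have hth : LipschitzWith (t.toNNReal * K) fun x => t • h x := by
    refine LipschitzWith.of_dist_le_mul fun x y => ?_
    rw [dist_smul₀, NNReal.coe_mul, Real.coe_toNNReal t ht, Real.norm_of_nonneg ht, mul_assoc]
    exact mul_le_mul_of_nonneg_left (hL.dist_le_mul x y) ht
  have hlt : t.toNNReal * K < 1 := by
    rw [← NNReal.coe_lt_coe]
    simpa [Real.coe_toNNReal t ht] using htK1
  set f : E → E := fun x => x + t • h x with hf
  have hinj : Function.Injective f := by
    intro x y hxy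
    have h1 : x - y = t • h y - t • h x := by
      have : x + t • h x = y + t • h y := hxy
      rw [sub_eq_sub_iff_add_eq_add, this, add_comm]
    have h2 := hth.dist_le_mul y x
    rw [dist_eq_norm, ← h1, dist_comm y x, dist_eq_norm] at h2
    have h3 : ((t.toNNReal * K : NNReal) : ℝ) < 1 := by exact_mod_cast hlt
    have h4 : ‖x - y‖ = 0 := by nlinarith [norm_nonneg (x - y)]
    exact sub_eq_zero.1 (norm_eq_zero.1 h4)
  have hsurj : Function.Surjective f := by
    intro y
    have hc : ContractingWith (t.toNNReal * K) fun x => y - t • h x :=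
      ⟨hlt, by simpa using (LipschitzWith.const y).sub hth⟩
    refine ⟨hc.fixedPoint, ?_⟩
    have := hc.fixedPoint_isFixedPt
    rw [Function.IsFixedPt] at this
    exact (sub_eq_iff_eq_add.1 this).symm
  have hout : ∀ x, x ∉ B → f x = x := fun x hx => by simp [hf, h0 x hx]
  have himg : f '' B = B := by
    apply Set.Subset.antisymm
    · rintro _ ⟨x, hx, rfl⟩
      by_contra hfx
      exact hfx (by rwa [hinj (hout _ hfx)])
    · intro y hy
      obtain ⟨x, rfl⟩ := hsurj y
      refine ⟨x, ?_, rfl⟩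
      by_contra hx
      exact hx (by rwa [hout x hx] at hy)
  have hder : ∀ x ∈ B, HasFDerivWithinAt f (1 + t • fderiv ℝ h x) B x := fun x hx =>
    ((hasFDerivAt_id x).add
      (((hd x hx).differentiableAt (hBo.mem_nhds hx)).hasFDerivAt.const_smul t)).hasFDerivWithinAt
  have key := integral_image_eq_integral_abs_det_fderiv_smul μ hBo.measurableSet hder
    hinj.injOn (fun _ => (1 : ℝ))
  rw [himg] at key
  simp only [smul_eq_mul, mul_one, integral_const, measureReal_restrict_apply_univ] at key
  rw [key]
  refine setIntegral_congr_fun hBo.measurableSet fun x _ => (abs_of_pos (hdet ?_)).symm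
  rw [dist_eq_norm, add_sub_cancel_left, norm_smul, Real.norm_of_nonneg ht]
  exact lt_of_le_of_lt (mul_le_mul_of_nonneg_left (norm_fderiv_le_of_lipschitz ℝ hL) ht) htKε

-- The integral is polynomial in `t` and constant for small `t`, hence constant.
open MeasureTheory in
theorem integral_det_one_add_smul_fderiv {E : Type*} [NormedAddCommGroup E]
    [NormedSpace ℝ E] [FiniteDimensional ℝ E] [MeasurableSpace E] [BorelSpace E]
    (μ : Measure E) [μ.IsAddHaarMeasure] {h : E → E} {K : NNReal} (hL : LipschitzWith K h)
    {B : Set E} (hBo : IsOpen B) (hB : μ B ≠ ⊤) (h0 : ∀ x, x ∉ B → h x = 0)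
    (hd : DifferentiableOn ℝ h B) (t : ℝ) :
    ∫ x in B, (1 + t • fderiv ℝ h x).det ∂μ = μ.real B := by
  obtain ⟨t₀, ht₀, hsmall⟩ := integral_det_one_add_smul_fderiv_of_small μ hL hBo h0 hd
  set n := Module.finrank ℝ E
  -- The indices `0, …, n` give `n + 1` distinct nodes in `[0, t₀)`.
  let v : ℕ → ℝ := fun i => t₀ * (i / (n + 1))
  have hv : Function.Injective v := by
    intro i j hij
    have h1 := mul_left_cancel₀ ht₀.ne' hij
    have h2 : (n : ℝ) + 1 ≠ 0 := by positivity
    exact_mod_cast (div_left_inj' h2).1 h1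
  have hcard : n < (Finset.range (n + 1)).card := by simp
  have hsum := fun A : E →L[ℝ] E =>
    continuousLinearMap_det_one_add_smul_eq_sum A (hv.injOn (s := Finset.range (n + 1))) hcard t
  simp_rw [hsum]
  rw [integral_finsetSum _ fun i _ =>
    (integrableOn_det_one_add_smul_fderiv μ hL hB (v i)).mul_const _]
  have hnode : ∀ i ∈ Finset.range (n + 1),
      ∫ x in B, (1 + v i • fderiv ℝ h x).det
        * (Lagrange.basis (Finset.range (n + 1)) v i).eval t ∂μ
      = μ.real B * (Lagrange.basis (Finset.range (n + 1)) v i).eval t := by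
    intro i hi
    rw [integral_mul_const, hsmall (v i) (by positivity)]
    have h1 : (i : ℝ) < n + 1 := by exact_mod_cast Finset.mem_range.1 hi
    have h2 : (i : ℝ) / (n + 1) < 1 := (div_lt_one (by positivity)).2 h1
    nlinarith
  rw [Finset.sum_congr rfl hnode, ← Finset.mul_sum, ← Polynomial.eval_finsetSum,
    Lagrange.sum_basis hv.injOn (by simp)]
  simp

/-! ### Brouwer's fixed point theorem. -/

/-- A segment leaving the ball crosses the sphere of radius `R`, where `h` already vanishes; the
part inside the ball carries the estimate. -/
theorem lipschitzWith_of_lipschitzOnWith_closedBall {E F : Type*} [NormedAddCommGroup E]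
    [NormedSpace ℝ E] [NormedAddCommGroup F] {h : E → F} {K : NNReal} {R : ℝ}
    (hK : LipschitzOnWith K h (Metric.closedBall 0 R)) (h0 : ∀ x, R ≤ ‖x‖ → h x = 0) :
    LipschitzWith K h := by
  have hmix : ∀ x y : E, ‖x‖ ≤ R → R ≤ ‖y‖ → dist (h x) (h y) ≤ K * dist x y := by
    intro x y hx hy
    have hc : ContinuousOn (fun s : ℝ => ‖x + s • (y - x)‖) (Set.Icc 0 1) := by fun_prop
    obtain ⟨s, hs, hsR⟩ := intermediate_value_Icc zero_le_one hc
      (show R ∈ Set.Icc _ _ by simpa using ⟨hx, hy⟩)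
    have hz : h (x + s • (y - x)) = h y := by rw [h0 _ hsR.ge, h0 y hy]
    rw [← hz]
    refine (hK.dist_le_mul x (by simpa using hx) _ (by simpa using hsR.le)).trans ?_
    refine mul_le_mul_of_nonneg_left ?_ K.2
    rw [dist_self_add_right, norm_smul, Real.norm_of_nonneg hs.1, dist_comm, dist_eq_norm]
    exact mul_le_of_le_one_left (norm_nonneg _) hs.2
  refine LipschitzWith.of_dist_le_mul fun x y => ?_
  rcases le_total ‖x‖ R with hx | hx <;> rcases le_total ‖y‖ R with hy | hy
  · exact hK.dist_le_mul x (by simpa using hx) y (by simpa using hy)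
  · exact hmix x y hx hy
  · rw [dist_comm, dist_comm x]
    exact hmix y x hy hx
  · rw [h0 x hx, h0 y hy, dist_self]
    positivity

/-- The determinant of a derivative of a map of constant norm vanishes. -/
theorem fderiv_det_eq_zero_of_norm_eq {E : Type*} [NormedAddCommGroup E]
    [InnerProductSpace ℝ E] [FiniteDimensional ℝ E] {φ : E → E} {R : ℝ} (hR : R ≠ 0)
    (hφ : ∀ x, ‖φ x‖ = R) {x : E} (hd : DifferentiableAt ℝ φ x) : (fderiv ℝ φ x).det = 0 := by
  by_contra hdet
  -- Differentiating the constant `‖φ‖ ^ 2` makes the range of the derivative orthogonal to `φ x ≠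
  -- 0`, so the derivative is not surjective.
  have horth : ∀ w, inner ℝ (φ x) (fderiv ℝ φ x w) = 0 := by
    intro w
    have h1 : HasFDerivAt (fun y => ‖φ y‖ ^ 2) (2 • (innerSL ℝ (φ x)).comp (fderiv ℝ φ x)) x :=
      hd.hasFDerivAt.norm_sq
    have h2 : HasFDerivAt (fun y => ‖φ y‖ ^ 2) (0 : E →L[ℝ] ℝ) x := by
      simp_rw [hφ]
      exact hasFDerivAt_const _ _
    have h3 := congrArg (fun A : E →L[ℝ] ℝ => A w) (h1.unique h2)
    simpa using h3
  have hsurj : Function.Surjective (fderiv ℝ φ x) := by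
    have h1 : IsUnit ((fderiv ℝ φ x : E →L[ℝ] E) : E →ₗ[ℝ] E) :=
      (LinearMap.isUnit_iff_isUnit_det _).2 (isUnit_iff_ne_zero.2 hdet)
    exact ((Module.End.isUnit_iff _).1 h1).2
  obtain ⟨w, hw⟩ := hsurj (φ x)
  have h4 := horth w
  rw [hw, real_inner_self_eq_norm_sq, hφ] at h4
  exact hR (by simpa using h4)

open MeasureTheory in
/-- A `C¹` self-map which is the identity outside a ball has a zero. -/
theorem exists_eq_zero_of_contDiff_of_eq_self {E : Type*} [NormedAddCommGroup E]
    [InnerProductSpace ℝ E] [FiniteDimensional ℝ E] {F : E → E} (hF : ContDiff ℝ 1 F)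
    {R : ℝ} (hR : 0 < R) (hid : ∀ x, R ≤ ‖x‖ → F x = x) : ∃ x, F x = 0 := by
  by_contra! hne
  let _ : MeasurableSpace E := borel E
  have : BorelSpace E := ⟨rfl⟩
  -- Radial projection of `F` onto the sphere of radius `R`; it fixes that sphere, so `φ x - x`
  -- extends by zero.
  set φ : E → E := fun x => (R / ‖F x‖) • F x with hφ
  have hφC : ContDiff ℝ 1 φ :=
    (contDiff_const.div (hF.norm ℝ hne) fun x => norm_ne_zero_iff.2 (hne x)).smul hF
  have hφn : ∀ x, ‖φ x‖ = R := fun x => by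
    have := norm_ne_zero_iff.2 (hne x)
    simp only [hφ, norm_smul, norm_div, norm_norm, Real.norm_of_nonneg hR.le]
    field_simp
  set h : E → E := fun x => if ‖x‖ < R then φ x - x else 0 with hh
  have hin : ∀ x ∈ Metric.closedBall (0 : E) R, h x = φ x - x := by
    intro x hx
    rw [mem_closedBall_zero_iff] at hx
    rcases hx.lt_or_eq with hx | hx
    · simp [hh, hx]
    · simp [hh, hφ, hid x hx.ge, hx, hR.ne']
  have hout : ∀ x, R ≤ ‖x‖ → h x = 0 := fun x hx => if_neg hx.not_gt
  obtain ⟨K, hK⟩ := LocallyLipschitzOn.exists_lipschitzOnWith_of_compact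
    (ProperSpace.isCompact_closedBall (0 : E) R)
    ((hφC.sub contDiff_id).locallyLipschitz.locallyLipschitzOn)
  have hL : LipschitzWith K h := by
    refine lipschitzWith_of_lipschitzOnWith_closedBall (R := R) ?_ hout
    intro x hx y hy
    rw [hin x hx, hin y hy]
    exact hK hx hy
  have hder : ∀ x ∈ Metric.ball (0 : E) R, HasFDerivAt h (fderiv ℝ φ x - 1) x := by
    intro x hx
    refine (((hφC.differentiable one_ne_zero).differentiableAt.hasFDerivAt).sub
      (hasFDerivAt_id x)).congr_of_eventuallyEq ?_
    filter_upwards [Metric.isOpen_ball.mem_nhds hx] with y hy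
    exact hin y (Metric.ball_subset_closedBall hy)
  -- At `t = 1` the integrand is `(fderiv ℝ φ x).det = 0`, so the ball would have volume zero.
  have key := integral_det_one_add_smul_fderiv (volume : Measure E) hL Metric.isOpen_ball
    measure_ball_lt_top.ne (fun x hx => hout x (by simpa using hx))
    (fun x hx => (hder x hx).differentiableAt.differentiableWithinAt) 1
  rw [setIntegral_congr_fun (g := fun _ => (0 : ℝ)) Metric.isOpen_ball.measurableSet] at key
  · rw [integral_zero] at key
    exact (ENNReal.toReal_pos (Metric.measure_ball_pos _ _ hR).ne' measure_ball_lt_top.ne).ne key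
  · intro x hx
    simp only [(hder x hx).fderiv, one_smul, add_sub_cancel]
    exact fderiv_det_eq_zero_of_norm_eq hR.ne' hφn (hφC.differentiable one_ne_zero).differentiableAt

open scoped Manifold ContDiff in
/-- A continuous self-map which is the identity outside a ball has a zero. -/
theorem exists_eq_zero_of_continuous_of_eq_self {E : Type*} [NormedAddCommGroup E]
    [InnerProductSpace ℝ E] [FiniteDimensional ℝ E] {F : E → E} (hF : Continuous F)
    {R : ℝ} (hR : 0 < R) (hid : ∀ x, R ≤ ‖x‖ → F x = x) : ∃ x, F x = 0 := by
  by_contra! hne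
  obtain ⟨x₀, -, hx₀⟩ := (ProperSpace.isCompact_closedBall (0 : E) R).exists_isMinOn
    ⟨0, by simpa using hR.le⟩ hF.norm.continuousOn
  have hδ : ∀ x, ‖x‖ ≤ R → ‖F x₀‖ ≤ ‖F x‖ := fun x hx => hx₀ (by simpa using hx)
  have hpos : 0 < ‖F x₀‖ := norm_pos_iff.2 (hne x₀)
  have hk : Continuous fun x => F x - x := hF.sub continuous_id
  -- A `C¹` approximation of `F x - x` that is exactly zero outside the ball and has error below the
  -- minimum of `‖F‖` inside, too small to create a zero of `x + g x`. Off the open ball the local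
  -- constant `0` works, since `F x - x = 0` there.
  obtain ⟨g, hg⟩ := exists_contMDiffMap_forall_mem_convex_of_local_const (n := 1) 𝓘(ℝ, E)
    (t := fun x => if ‖x‖ < R then Metric.ball (F x - x) ‖F x₀‖ else {0})
    (by
      intro x
      split_ifs
      · exact convex_ball _ _
      · exact convex_singleton _)
    (by
      intro x
      by_cases hx : ‖x‖ < R
      · refine ⟨F x - x, ?_⟩
        filter_upwards [continuous_norm.continuousAt.eventually (gt_mem_nhds hx),
          hk.continuousAt.eventually (Metric.ball_mem_nhds _ hpos)] with y hy hy'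
        rw [if_pos hy, Metric.mem_ball, dist_comm]
        exact hy'
      · refine ⟨0, ?_⟩
        have hx0 : F x - x = 0 := sub_eq_zero.2 (hid x (not_lt.1 hx))
        filter_upwards [hk.continuousAt.eventually (Metric.ball_mem_nhds _ hpos)] with y hy
        split_ifs
        · rw [Metric.mem_ball, dist_comm, ← hx0]
          exact hy
        · rfl)
  obtain ⟨x, hx⟩ := exists_eq_zero_of_contDiff_of_eq_self
    (contDiff_id.add g.contMDiff.contDiff) hR (fun x hx => by
      have := hg x
      rw [if_neg hx.not_gt] at this
      simpa using this)
  have hgx := hg x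
  have hgx' : g x = -x := by
    have : x + g x = 0 := hx
    exact (neg_eq_of_add_eq_zero_right this).symm
  split_ifs at hgx with hlt
  · rw [Metric.mem_ball, hgx', dist_eq_norm, ← norm_neg] at hgx
    have := hδ x hlt.le
    rw [show -(-x - (F x - x)) = F x by abel] at hgx
    exact absurd hgx this.not_gt
  · have hx0 : x = 0 := by
      rw [hgx'] at hgx
      simpa using hgx
    exact hlt (by simpa [hx0] using hR)

/-- **Brouwer's fixed point theorem** for bounded continuous self-maps. -/
theorem exists_isFixedPt_of_continuous_of_bounded {E : Type*} [NormedAddCommGroup E]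
    [InnerProductSpace ℝ E] [FiniteDimensional ℝ E] {f : E → E} (hf : Continuous f) {M : ℝ}
    (hM : ∀ x, ‖f x‖ ≤ M) : ∃ x, f x = x := by
  -- A cutoff equal to `1` for `‖x‖ ≤ M + 1` and to `0` for `‖x‖ ≥ M + 2`. A zero of `x - c x • f x`
  -- has norm at most `M`, where the cutoff is inactive.
  let c : E → ℝ := fun x => max 0 (min 1 (M + 2 - ‖x‖))
  have hM0 : 0 ≤ M := (norm_nonneg _).trans (hM 0)
  obtain ⟨x, hx⟩ := exists_eq_zero_of_continuous_of_eq_self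
    (F := fun x => x - c x • f x) (R := M + 2) (by fun_prop) (by linarith) (fun x hx => by
      have : c x = 0 := max_eq_left ((min_le_right _ _).trans (by linarith))
      simp [this])
  refine ⟨x, ?_⟩
  have hxe : x = c x • f x := sub_eq_zero.1 hx
  have hc0 : 0 ≤ c x := le_max_left _ _
  have hc1 : c x ≤ 1 := max_le zero_le_one (min_le_left _ _)
  have hxM : ‖x‖ ≤ M := by
    rw [hxe, norm_smul, Real.norm_of_nonneg hc0]
    exact (mul_le_of_le_one_left (norm_nonneg _) hc1).trans (hM x)
  have : c x = 1 := by
    simp only [c]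
    rw [min_eq_left (by linarith), max_eq_right zero_le_one]
  rw [this, one_smul] at hxe
  exact hxe.symm

/-! ### Variational inequalities on compact convex sets. -/

/-- The metric projection onto a complete convex set. -/
theorem exists_lipschitzWith_projection {E : Type*} [NormedAddCommGroup E]
    [InnerProductSpace ℝ E] {C : Set E} (hne : C.Nonempty) (hcomp : IsComplete C)
    (hconv : Convex ℝ C) :
    ∃ π : E → E, LipschitzWith 1 π ∧ (∀ x, π x ∈ C) ∧
      ∀ x, ∀ w ∈ C, inner ℝ (x - π x) (w - π x) ≤ 0 := by
  choose π hπC hπ using exists_norm_eq_iInf_of_complete_convex hne hcomp hconv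
  have hvar : ∀ x, ∀ w ∈ C, inner ℝ (x - π x) (w - π x) ≤ 0 := fun x =>
    (norm_eq_iInf_iff_real_inner_le_zero hconv (hπC x)).1 (hπ x)
  refine ⟨π, LipschitzWith.of_dist_le_mul fun x y => ?_, hπC, hvar⟩
  have h1 := hvar x (π y) (hπC y)
  have h2 := hvar y (π x) (hπC x)
  -- Sum of the two obtuse-angle inequalities; Cauchy–Schwarz then gives the Lipschitz bound.
  have h3 : ‖π x - π y‖ ^ 2 ≤ inner ℝ (x - y) (π x - π y) := by
    rw [← real_inner_self_eq_norm_sq]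
    simp only [inner_sub_left, inner_sub_right] at h1 h2 ⊢
    rw [real_inner_comm (π x) (π y)] at *
    linarith
  have h4 := real_inner_le_norm (x - y) (π x - π y)
  rw [NNReal.coe_one, one_mul, dist_eq_norm, dist_eq_norm]
  by_contra! h5
  nlinarith [norm_nonneg (x - y)]

/-- A continuous vector field on a compact convex set solves the variational inequality. -/
theorem exists_forall_inner_sub_le_zero {E : Type*} [NormedAddCommGroup E]
    [InnerProductSpace ℝ E] [FiniteDimensional ℝ E] {C : Set E} (hne : C.Nonempty)
    (hcomp : IsCompact C) (hconv : Convex ℝ C) {Φ : E → E} (hΦ : Continuous Φ) :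
    ∃ z ∈ C, ∀ w ∈ C, inner ℝ (Φ z) (w - z) ≤ 0 := by
  obtain ⟨π, hπL, hπC, hπ⟩ := exists_lipschitzWith_projection hne hcomp.isComplete hconv
  obtain ⟨M, hM⟩ := hcomp.isBounded.exists_norm_le
  -- At a fixed point of `x ↦ π (x + Φ x)` the obtuse-angle condition is the variational inequality.
  obtain ⟨z, hz⟩ := exists_isFixedPt_of_continuous_of_bounded
    (hπL.continuous.comp (continuous_id.add hΦ)) (fun x => hM _ (hπC _))
  have hz' : π (z + Φ z) = z := hz
  refine ⟨z, hz' ▸ hπC _, fun w hw => ?_⟩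
  have := hπ (z + Φ z) w hw
  rwa [hz', add_sub_cancel_left] at this

theorem exists_forall_sum_mul_sub_le_zero {ι : Type*} [Fintype ι] {C : Set (ι → ℝ)}
    (hne : C.Nonempty) (hcomp : IsCompact C) (hconv : Convex ℝ C)
    {Φ : (ι → ℝ) → ι → ℝ} (hΦ : Continuous Φ) :
    ∃ z ∈ C, ∀ w ∈ C, ∑ i, Φ z i * (w i - z i) ≤ 0 := by
  let e : EuclideanSpace ℝ ι ≃L[ℝ] (ι → ℝ) := EuclideanSpace.equiv ι ℝ
  obtain ⟨z, hz, h⟩ := exists_forall_inner_sub_le_zero (C := e.symm '' C)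
    (Φ := fun x => e.symm (Φ (e x))) (hne.image _) (hcomp.image e.symm.continuous)
    (hconv.linear_image (e.symm : (ι → ℝ) →ₗ[ℝ] EuclideanSpace ℝ ι))
    (e.symm.continuous.comp (hΦ.comp e.continuous))
  obtain ⟨z, hz, rfl⟩ := hz
  refine ⟨z, hz, fun w hw => ?_⟩
  have := h _ ⟨w, hw, rfl⟩
  rw [e.apply_symm_apply] at this
  simpa [PiLp.inner_apply, e, mul_comm] using this

/-! ### Realisation probabilities and Kuhn's theorem. -/

namespace KyleGame

variable {G : KyleGame}

/-- The insider's node in an earlier round on the path to a given node. -/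
def InsiderNode.restrict {t : Fin G.T} (τ : G.InsiderNode t) (s : Fin G.T) (h : s ≤ t) :
    G.InsiderNode s where
  cell r := τ.cell ⟨r, r.2.trans h⟩
  cell_mem r := τ.cell_mem ⟨r, r.2.trans h⟩
  cell_anti _ _ hr := τ.cell_anti hr
  x r := τ.x ⟨r, lt_of_lt_of_le r.2 h⟩
  z r := τ.z ⟨r, lt_of_lt_of_le r.2 h⟩

/-- The probability that the insider's choices before a node agree with the path to that node. -/
noncomputable def InsiderNode.reach (ξ : G.BehaviourStrategy) {t : Fin G.T}
    (τ : G.InsiderNode t) : ℝ :=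
  ∏ s : Set.Iio t, ξ s (τ.restrict s s.2.le) (τ.x s)

theorem InsiderNode.reach_nonneg (ξ : G.BehaviourStrategy) {t : Fin G.T}
    (τ : G.InsiderNode t) : 0 ≤ τ.reach ξ :=
  Finset.prod_nonneg fun s _ => (ξ s _).2.1 _

/-- The probability that the insider's choices in the first `k` rounds agree with an outcome. -/
noncomputable def Outcome.reach (ξ : G.BehaviourStrategy) (ω : G.Outcome) (k : ℕ) : ℝ :=
  ∏ s : Fin G.T with s.val < k, ξ s (ω.node s) (ω.x s)

theorem Outcome.reach_node (ξ : G.BehaviourStrategy) (ω : G.Outcome) (t : Fin G.T) :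
    (ω.node t).reach ξ = ω.reach ξ t := by
  have h : (Finset.univ.filter fun s : Fin G.T => s.val < t.val) = Finset.Iio t := by
    ext s
    simp
  rw [Outcome.reach, h]
  exact (Finset.prod_subtype (Finset.Iio t) (p := fun s => s ∈ Set.Iio t) (by simp)
    fun s => ξ s (ω.node s) (ω.x s)).symm

theorem Outcome.reach_zero (ξ : G.BehaviourStrategy) (ω : G.Outcome) : ω.reach ξ 0 = 1 := by
  simp [Outcome.reach]

theorem Outcome.reach_succ (ξ : G.BehaviourStrategy) (ω : G.Outcome) (t : Fin G.T) :
    ω.reach ξ (t + 1) = ω.reach ξ t * ξ t (ω.node t) (ω.x t) := by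
  have h : (Finset.univ.filter fun s : Fin G.T => s.val < t.val + 1)
      = insert t (Finset.univ.filter fun s : Fin G.T => s.val < t.val) := by
    ext s
    simp only [Finset.mem_filter, Finset.mem_univ, true_and, Finset.mem_insert, Fin.ext_iff]
    omega
  rw [Outcome.reach, h, Finset.prod_insert (by simp), mul_comm]
  rfl

/-- The factors of chance do not involve the strategy, so mixing outcome distributions reduces to
mixing `reach`. -/
theorem prob_eq_reach (ξ : G.BehaviourStrategy) (ω : G.Outcome) :
    prob ξ ω = G.ν ω.state * (∏ s, G.ζ (ω.z s)) * ω.reach ξ G.T := by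
  have h : (Finset.univ.filter fun s : Fin G.T => s.val < G.T) = Finset.univ := by
    ext s
    simp
  rw [prob, Outcome.reach, h, Finset.prod_mul_distrib]
  ring

theorem prob_nonneg (ξ : G.BehaviourStrategy) (ω : G.Outcome) : 0 ≤ prob ξ ω :=
  mul_nonneg (G.ν.2.1 _) (Finset.prod_nonneg fun s _ =>
    mul_nonneg ((ξ s _).2.1 _) (G.ζ.2.1 _))

/-- The behaviour strategy that is realisation equivalent to the mixture of `ξ` and `η` with
weights `a` and `b`. -/
noncomputable def mix (a b : ℝ) (ha : 0 ≤ a) (hb : 0 ≤ b) (ξ η : G.BehaviourStrategy) :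
    G.BehaviourStrategy := fun t τ =>
  -- The value at a node of zero mixed reach is arbitrary.
  if h : a * τ.reach ξ + b * τ.reach η = 0 then ξ t τ
  else ⟨fun x => (a * τ.reach ξ * ξ t τ x + b * τ.reach η * η t τ x)
      / (a * τ.reach ξ + b * τ.reach η), by
    have h1 := mul_nonneg ha (τ.reach_nonneg ξ)
    have h2 := mul_nonneg hb (τ.reach_nonneg η)
    refine ⟨fun x => div_nonneg (add_nonneg (mul_nonneg h1 ((ξ t τ).2.1 x))
      (mul_nonneg h2 ((η t τ).2.1 x))) (add_nonneg h1 h2), ?_⟩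
    have h3 : ∑ x, ξ t τ x = 1 := (ξ t τ).2.2
    have h4 : ∑ x, η t τ x = 1 := (η t τ).2.2
    rw [← Finset.sum_div, Finset.sum_add_distrib, ← Finset.mul_sum, ← Finset.mul_sum, h3, h4,
      mul_one, mul_one, div_self h]⟩

theorem reach_mul_mix {a b : ℝ} (ha : 0 ≤ a) (hb : 0 ≤ b) (ξ η : G.BehaviourStrategy)
    {t : Fin G.T} (τ : G.InsiderNode t) (x : G.EX) :
    (a * τ.reach ξ + b * τ.reach η) * mix a b ha hb ξ η t τ x
      = a * τ.reach ξ * ξ t τ x + b * τ.reach η * η t τ x := by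
  by_cases h : a * τ.reach ξ + b * τ.reach η = 0
  · have h1 := mul_nonneg ha (τ.reach_nonneg ξ)
    have h2 := mul_nonneg hb (τ.reach_nonneg η)
    rw [h, show a * τ.reach ξ = 0 by linarith, show b * τ.reach η = 0 by linarith]
    ring
  · rw [mix, dif_neg h]
    exact mul_div_cancel₀ _ h

/-- By induction on the round, the mixed reach of a node is the denominator in `mix`, so the two
cancel. -/
theorem Outcome.reach_mix {a b : ℝ} (ha : 0 ≤ a) (hb : 0 ≤ b) (hab : a + b = 1)
    (ξ η : G.BehaviourStrategy) (ω : G.Outcome) {k : ℕ} (hk : k ≤ G.T) :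
    ω.reach (mix a b ha hb ξ η) k = a * ω.reach ξ k + b * ω.reach η k := by
  induction k with
  | zero => simp [Outcome.reach_zero, hab]
  | succ k ih =>
    have h := reach_mul_mix ha hb ξ η (ω.node ⟨k, hk⟩) (ω.x ⟨k, hk⟩)
    rw [Outcome.reach_node, Outcome.reach_node] at h
    have hs := fun θ : G.BehaviourStrategy => ω.reach_succ θ ⟨k, hk⟩
    simp only at hs h
    rw [hs, hs, hs, ih (by omega), h]
    ring

/-- Kuhn's theorem: the outcome distributions of behaviour strategies form a convex set. -/
theorem convex_range_prob : Convex ℝ (Set.range (prob (G := G))) := by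
  rintro _ ⟨ξ, rfl⟩ _ ⟨η, rfl⟩ a b ha hb hab
  refine ⟨mix a b ha hb ξ η, ?_⟩
  funext ω
  simp only [Pi.add_apply, Pi.smul_apply, smul_eq_mul, prob_eq_reach,
    ω.reach_mix ha hb hab ξ η le_rfl]
  ring

theorem continuous_prob : Continuous (prob (G := G)) := by
  refine continuous_pi fun ω => continuous_const.mul (continuous_finsetProd _ fun s _ =>
    Continuous.mul ?_ continuous_const)
  exact (continuous_apply (ω.x s)).comp
    (continuous_subtype_val.comp ((continuous_apply (ω.node s)).comp (continuous_apply s)))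

theorem isCompact_range_prob : IsCompact (Set.range (prob (G := G))) :=
  isCompact_range continuous_prob

/-! ### The variational inequality of the game. -/

theorem vMin_le (i : Fin G.N) : G.vMin ≤ G.v i :=
  G.v_anti (Fin.le_def.2 (Nat.le_sub_one_of_lt i.2))

theorem le_vMax (i : Fin G.N) : G.v i ≤ G.vMax :=
  G.v_anti (Fin.le_def.2 (Nat.zero_le _))

variable (G) in
/-- The pairs of a round and an order flow at which a price is quoted. -/
abbrev PriceNode : Type := Σ t : Fin G.T, (Set.Iic t → G.EY)

/-- The order flow of an outcome up to a round. -/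
def Outcome.priceNode (ω : G.Outcome) (t : Fin G.T) : G.PriceNode := ⟨t, fun s => ω.flow s⟩

/-- The payoff at arbitrary real prices. -/
noncomputable def linearPayoff (ω : G.Outcome) (S : G.PriceNode → ℝ) : ℝ :=
  ∑ t : Fin G.T, (G.v ω.state - S (ω.priceNode t)) * (ω.x t : ℝ)

open Classical in
/-- The joint weight of a state and an order flow under an arbitrary weight of outcomes. -/
noncomputable def jointWeight (p : G.Outcome → ℝ) (i : Fin G.N) (y : G.PriceNode) : ℝ :=
  ∑ ω : G.Outcome with ω.state = i ∧ ∀ s : Set.Iic y.1, ω.flow s = y.2 s, p ω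

/-- The insider's marginal payoffs and the marginal decrease of the market maker's quadratic
pricing error. -/
noncomputable def gameField (q : G.Outcome ⊕ G.PriceNode → ℝ) : G.Outcome ⊕ G.PriceNode → ℝ :=
  Sum.elim (fun ω => linearPayoff ω (q ∘ Sum.inr))
    -- Derivative in the price `s` at `y` of `-½ ∑ i, p(i, y) (v i - s)²`.
    (fun y => ∑ i, jointWeight (q ∘ Sum.inl) i y * (G.v i - q (Sum.inr y)))

theorem continuous_gameField : Continuous (gameField (G := G)) := by
  refine continuous_pi fun a => ?_
  rcases a with ω | y
  · simp only [gameField, Sum.elim_inl, linearPayoff, Function.comp_apply]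
    fun_prop
  · simp only [gameField, Sum.elim_inr, jointWeight, Function.comp_apply]
    fun_prop

theorem jointProb_nonneg (ξ : G.BehaviourStrategy) (t : Fin G.T) (i : Fin G.N)
    (y : Set.Iic t → G.EY) : 0 ≤ jointProb ξ t i y :=
  Finset.sum_nonneg fun _ _ => prob_nonneg _ _

theorem sum_condProb_mul_mem_Icc {ξ : G.BehaviourStrategy} {t : Fin G.T}
    {y : Set.Iic t → G.EY} (h : 0 < flowProb ξ t y) :
    ∑ i, condProb ξ t i y * G.v i ∈ Set.Icc G.vMin G.vMax := by
  have h0 : ∀ i, 0 ≤ condProb ξ t i y := fun i => div_nonneg (jointProb_nonneg ξ t i y) h.le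
  have h1 : ∑ i, condProb ξ t i y = 1 := by
    simp only [condProb]
    rw [← Finset.sum_div]
    exact div_self h.ne'
  constructor
  · calc G.vMin = ∑ i, condProb ξ t i y * G.vMin := by rw [← Finset.sum_mul, h1, one_mul]
      _ ≤ _ := Finset.sum_le_sum fun i _ => mul_le_mul_of_nonneg_left (vMin_le i) (h0 i)
  · calc _ ≤ ∑ i, condProb ξ t i y * G.vMax :=
        Finset.sum_le_sum fun i _ => mul_le_mul_of_nonneg_left (le_vMax i) (h0 i)
      _ = G.vMax := by rw [← Finset.sum_mul, h1, one_mul]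

/-- Identifies the market maker's marginal incentive as a positive multiple of the gap between
conditional expectation and price. -/
theorem flowProb_mul_sum_condProb_sub {ξ : G.BehaviourStrategy} {t : Fin G.T}
    {y : Set.Iic t → G.EY} (h : 0 < flowProb ξ t y) (c : ℝ) :
    flowProb ξ t y * (∑ i, condProb ξ t i y * G.v i - c)
      = ∑ i, jointProb ξ t i y * (G.v i - c) := by
  have h1 : flowProb ξ t y * ∑ i, condProb ξ t i y * G.v i = ∑ i, jointProb ξ t i y * G.v i := by
    rw [Finset.mul_sum]
    refine Finset.sum_congr rfl fun i _ => ?_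
    rw [condProb, ← mul_assoc, mul_div_cancel₀ _ h.ne']
  simp only [mul_sub, Finset.sum_sub_distrib, h1, ← Finset.sum_mul]
  rfl

variable (G) in
/-- A solution of the variational inequality of the game between insider and market maker. -/
theorem exists_variational_solution :
    ∃ (ξ : G.BehaviourStrategy) (s : G.PriceNode → ℝ),
      (∀ y, s y ∈ Set.Icc G.vMin G.vMax) ∧
      (∀ ξ' : G.BehaviourStrategy, ∑ ω, linearPayoff ω s * (prob ξ' ω - prob ξ ω) ≤ 0) ∧
      ∀ s' : G.PriceNode → ℝ, (∀ y, s' y ∈ Set.Icc G.vMin G.vMax) →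
        ∑ y : G.PriceNode, (∑ i, jointProb ξ y.1 i y.2 * (G.v i - s y)) * (s' y - s y) ≤ 0 := by
  have : Nonempty G.EX := G.EX_nonempty.to_subtype
  let C : Set (G.Outcome ⊕ G.PriceNode → ℝ) := (fun q => Sum.elim q.1 q.2) ''
    (Set.range (prob (G := G)) ×ˢ Set.univ.pi fun _ : G.PriceNode => Set.Icc G.vMin G.vMax)
  have hmem : ∀ (ξ : G.BehaviourStrategy) (s : G.PriceNode → ℝ),
      (∀ y, s y ∈ Set.Icc G.vMin G.vMax) → Sum.elim (prob ξ) s ∈ C := fun ξ s hs =>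
    ⟨(prob ξ, s), ⟨⟨ξ, rfl⟩, fun y _ => hs y⟩, rfl⟩
  obtain ⟨x₀⟩ : Nonempty G.BehaviourStrategy := inferInstance
  have hne : C.Nonempty := ⟨_, hmem x₀ (fun _ => G.vMin) fun y =>
    ⟨le_rfl, (vMin_le ⟨0, G.N_pos⟩).trans (le_vMax _)⟩⟩
  have hcomp : IsCompact C := (isCompact_range_prob.prod
    (isCompact_univ_pi fun _ => isCompact_Icc)).image
      (continuous_pi fun a => by
        rcases a with a | a <;> simp only [Sum.elim_inl, Sum.elim_inr] <;> fun_prop)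
  have hconv : Convex ℝ C := by
    refine (convex_range_prob.prod (convex_pi fun _ _ => convex_Icc _ _)).is_linear_image
      ⟨fun p q => ?_, fun c p => ?_⟩
    · funext a
      rcases a with a | a <;> rfl
    · funext a
      rcases a with a | a <;> rfl
  obtain ⟨_, ⟨⟨_, s⟩, ⟨⟨ξ, rfl⟩, hs⟩, rfl⟩, hVI⟩ :=
    exists_forall_sum_mul_sub_le_zero hne hcomp hconv continuous_gameField
  have hs' : ∀ y, s y ∈ Set.Icc G.vMin G.vMax := fun y => hs y trivial
  refine ⟨ξ, s, hs', fun ξ' => ?_, fun s' hs'' => ?_⟩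
  -- Comparison points that change only one player's component decouple the inequality.
  · have := hVI _ (hmem ξ' s hs')
    rw [Fintype.sum_sum_type] at this
    simpa [gameField, Function.comp_def] using this
  · have := hVI _ (hmem ξ s' hs'')
    rw [Fintype.sum_sum_type] at this
    simpa [gameField, Function.comp_def, jointWeight, jointProb] using this

end KyleGame

/-! ### From the variational solution to the equilibrium. -/

open KyleGame in
theorem theorem1 (G : KyleGame) :
    ∃ (ξ : G.BehaviourStrategy) (S : G.PricingSystem), KyleGame.IsKyleEquilibrium ξ S := by
  classical
  obtain ⟨ξ, s, hs, hprofit, hprice⟩ := exists_variational_solution G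
  refine ⟨ξ, fun t y => ⟨s ⟨t, y⟩, hs _⟩, fun ξ' => ?_, fun t y hy => ?_⟩
  · have := hprofit ξ'
    simp only [mul_sub, Finset.sum_sub_distrib, sub_nonpos] at this
    simp only [utility, mul_comm (prob _ _)]
    exact this
  · set m := ∑ i, condProb ξ t i y * G.v i with hm
    -- Moving only the price at `(t, y)` to `m` turns the inequality into `flowProb ξ t y * (m - s
    -- ⟨t, y⟩) ^ 2 ≤ 0`.
    have := hprice (Function.update s ⟨t, y⟩ m) fun y' => by
      rcases eq_or_ne y' ⟨t, y⟩ with rfl | h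
      · rw [Function.update_self]
        exact sum_condProb_mul_mem_Icc hy
      · rw [Function.update_of_ne h]
        exact hs y'
    rw [Finset.sum_eq_single (⟨t, y⟩ : G.PriceNode) (fun y' _ h => by
      rw [Function.update_of_ne h, sub_self, mul_zero]) (by simp),
      Function.update_self, ← flowProb_mul_sum_condProb_sub hy, ← hm] at this
    have h1 : (m - s ⟨t, y⟩) ^ 2 ≤ 0 := by
      by_contra! hlt
      nlinarith [mul_pos hy hlt]
    have h2 : m - s ⟨t, y⟩ = 0 := pow_eq_zero_iff two_ne_zero |>.1 (le_antisymm h1 (sq_nonneg _))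
    exact (sub_eq_zero.1 h2).symm
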